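/- Let $\mathcal H$ be a real Hilbert space, $\mathcal G$ a real normed space, $\mathcal D\subset\mathcal G$ with the induced topology, and let $I_1,I_2$ be disjoint finite index sets with $I_1\cup I_2\neq\emptyset$. Let $f_i:\mathcal D\to\mathbb R$ and $g_i:\mathcal D\to\mathcal H$, $i\in I_1\cup I_2$, be locally Lipschitz, and for $p\in\mathcal D$ put $$C(p)=\{x\in\mathcal H:\ \langle x,g_i(p)\rangle=f_i(p)\ (i\in I_1),\ \langle x,g_i(p)\rangle\le f_i(p)\ (i\in I_2)\}.$$ For $x\in C(p)$ let $N(x;C(p))=\{h\in\mathcal H:\langle h,y-x\rangle\le 0\ \ \forall y\in C(p)\}$, and let $$Gr(p)=\{(x,x'):\ x\in C(p),\ x'\in N(x;C(p))\}\subset\mathcal H\times\mathcal H .$$ Let $\bar p\in\mathcal D$ with $C(\bar p)\ne\emptyset$, let $\bar v\in\mathcal H\setminus C(\bar p)$, and let $\bar x=P(\bar v,\bar p)$ be the metric projection of $\bar v$ onto $C(\bar p)$. Assume that there are disjoint finite index sets $\tilde I_1,\tilde I_2$ with $\tilde I_1\cup\tilde I_2\ne\emptyset$ and locally Lipschitz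 $\tilde f_i:\mathcal D\to\mathbb R$, $\tilde g_i:\mathcal D\to\mathcal H$, $i\in\tilde I_1\cup\tilde I_2$, such that for all $p\in\mathcal D$ $$C(p)=\{x\in\mathcal H:\ \langle x,\tilde g_i(p)\rangle=\tilde f_i(p)\ (i\in\tilde I_1),\ \langle x,\tilde g_i(p)\rangle\le\tilde f_i(p)\ (i\in\tilde I_2)\}$$ (an equivalent representation $\mathcal R$), and such that, with $I=\{i\in\tilde I_1\cup\tilde I_2:\langle\bar x,\tilde g_i(\bar p)\rangle=\tilde f_i(\bar p)\}$, the following hold. 1. (The representation is stable at $(\bar p,\bar v,\bar x)$.) There is $\bar K\subset I\cap\tilde I_2$ such that the vectors $\tilde g_i(\bar p)$, $i\in\tilde I_1\cup\bar K$, are linearly independent, $\bar v-\bar x=\sum_{i\in\tilde I_1\cup\bar K}\bar\lambda_i\tilde g_i(\bar p)$ for some real $\bar\lambda_i$ with $\bar\lambda_i>0$ for $i\in\bar K$, and, for every (possibly empty) $L\subset(I\cap\tilde I_2)\setminus\bar K$ for which $\tilde g_i(\bar p)$, $i\in\tilde I_1\cup\bar K\cup L$, are linearly independent, the point $\bar x$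 belongs to the lower Kuratowski limit $\liminf_{p\to\bar p,\,p\in\mathcal D}R_{\bar K,L}(p)$, where $$R_{\bar K,L}(p)=\{x\in\mathcal H:\ \langle x,\tilde g_i(p)\rangle=\tilde f_i(p)\ (i\in\tilde I_1\cup\bar K\cup L),\ \langle x,\tilde g_i(p)\rangle\le\tilde f_i(p)\ (i\in\tilde I_2\setminus(\bar K\cup L))\};$$ that is, for every neighbourhood $V$ of $\bar x$ there is a neighbourhood $U$ of $\bar p$ in $\mathcal D$ such that $V\cap R_{\bar K,L}(p)\neq\emptyset$ for all $p\in U$. 2. (The representation satisfies RCRCQ at $(\bar p,\bar x)$.) There is a neighbourhood $U$ of $\bar p$ in $\mathcal D$ such that for every $J$ with $\tilde I_1\subset J\subset I$ and every $p\in U$, $\operatorname{rank}\{\tilde g_i(p):i\in J\}=\operatorname{rank}\{\tilde g_i(\bar p):i\in J\}$. Then $Gr:\mathcal D\rightrightarrows\mathcal H\times\mathcal H$ is Lipschitz-like around $(\bar p,\bar x,\bar v-\bar x)$: one has $(\bar x,\bar v-\bar x)\in Gr(\bar p)$, and there are $\ell\ge0$, a neighbourhood $U$ of $\bar p$ in $\mathcal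 D$ and a neighbourhood $V$ of $(\bar x,\bar v-\bar x)$ in $\mathcal H\times\mathcal H$ such that $$Gr(p_1)\cap V\subset Gr(p_2)+\ell\,\|p_1-p_2\|\,B(0,1)\qquad\text{for all }p_1,p_2\in U,$$ where $B(0,1)$ is the open unit ball of $\mathcal H\times\mathcal H$. -/

import Mathlib

open scoped Topology Pointwise

/-- The normal cone `N(x; C)`, in the sense of convex analysis, to the set `C` at `x`. -/
def convexNormalCone {H : Type*} [NormedAddCommGroup H] [InnerProductSpace ℝ H]
    (C : Set H) (x : H) : Set H :=
  {h | ∀ y ∈ C, inner ℝ h (y - x) ≤ 0}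

/-- `x` is the metric projection of `v` onto `C`, i.e. `x` minimizes the distance to `v` over `C`
(if `C` is closed, convex and nonempty, there is exactly one such `x`). -/
def IsMetricProjection {H : Type*} [NormedAddCommGroup H] (C : Set H) (v x : H) : Prop :=
  x ∈ C ∧ ∀ y ∈ C, ‖v - x‖ ≤ ‖v - y‖

/-- `y` lies in the lower Kuratowski limit of the multifunction `F` at `a`: every neighbourhood
of `y` meets all the values `F p` with `p` close to `a`. -/
def MemKuratowskiLiminf {X Y : Type*} [TopologicalSpace X] [TopologicalSpace Y]
    (F : X → Set Y) (a : X) (y : Y) : Prop :=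
  ∀ V ∈ 𝓝 y, ∃ U ∈ 𝓝 a, ∀ p ∈ U, (V ∩ F p).Nonempty

/-- The multifunction `F : D ⇉ Y` is Lipschitz-like (has the Aubin property) around the point
`(u, y)` of its graph, for some modulus `ℓ ≥ 0`. Neighbourhoods of `u` are taken in `D`. -/
def IsLipschitzLike {G Y : Type*} [NormedAddCommGroup G] [NormedAddCommGroup Y] [NormedSpace ℝ Y]
    {D : Set G} (F : D → Set Y) (u : D) (y : Y) : Prop :=
  y ∈ F u ∧ ∃ ℓ : ℝ, 0 ≤ ℓ ∧ ∃ U ∈ 𝓝 u, ∃ V ∈ 𝓝 y, ∀ u₁ ∈ U, ∀ u₂ ∈ U,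
    F u₁ ∩ V ⊆ F u₂ + (ℓ * ‖(u₁ : G) - (u₂ : G)‖) • Metric.ball (0 : Y) 1

/-- A parametric system of affine constraints with index set `ι` and parameter `p ∈ D`:
`⟨x, g i p⟩ = f i p` for `i ∈ eqs` and `⟨x, g i p⟩ ≤ f i p` for the other indices,
with locally Lipschitz data. -/
structure AffineSystem {G : Type*} [NormedAddCommGroup G] (D : Set G)
    (H : Type*) [NormedAddCommGroup H] (ι : Type*) where
  /-- The set of indices of the equality constraints. -/
  eqs : Finset ι
  /-- The right-hand sides. -/
  f : ι → D → ℝ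
  /-- The left-hand sides. -/
  g : ι → D → H
  locallyLipschitz_f : ∀ i, LocallyLipschitz (f i)
  locallyLipschitz_g : ∀ i, LocallyLipschitz (g i)

namespace AffineSystem

section

variable {G : Type*} [NormedAddCommGroup G] {D : Set G}
  {H : Type*} [NormedAddCommGroup H] [InnerProductSpace ℝ H] {ι : Type*}

/-- The multifunction `p ↦ C(p)` given by the system. -/
def feasible (S : AffineSystem D H ι) (p : D) : Set H :=
  {x | (∀ i ∈ S.eqs, inner ℝ x (S.g i p) = S.f i p) ∧
    ∀ i ∉ S.eqs, inner ℝ x (S.g i p) ≤ S.f i p}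

/-- The graphical normal-cone multifunction `Gr(p) = gph N(·; C(p))`. -/
def graphNormalCone (S : AffineSystem D H ι) (p : D) : Set (H × H) :=
  {z | z.1 ∈ S.feasible p ∧ z.2 ∈ convexNormalCone (S.feasible p) z.1}

/-- The set of active indices for the parameter `p` at the point `x`. -/
def active (S : AffineSystem D H ι) (p : D) (x : H) : Set ι :=
  {i | inner ℝ x (S.g i p) = S.f i p}

/-- The active indices of inequality constraints for the parameter `p` at the point `x`. -/
def activeIneq (S : AffineSystem D H ι) (p : D) (x : H) : Set ι :=
  {i | i ∉ S.eqs ∧ i ∈ S.active p x}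

/-- The relaxed constant rank constraint qualification at `(p₀, x₀)`, where `x₀` is feasible
for `p₀`. -/
def RCRCQ (S : AffineSystem D H ι) (p₀ : D) (x₀ : H) : Prop :=
  ∃ U ∈ 𝓝 p₀, ∀ J : Set ι, (S.eqs : Set ι) ⊆ J → J ⊆ S.active p₀ x₀ → ∀ p ∈ U,
    Set.finrank ℝ ((fun i => S.g i p) '' J) = Set.finrank ℝ ((fun i => S.g i p₀) '' J)

/-- The system obtained by turning the constraints with indices in `J` into equalities. -/
def tighten [DecidableEq ι] (S : AffineSystem D H ι) (J : Finset ι) : AffineSystem D H ι where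
  eqs := S.eqs ∪ J
  f := S.f
  g := S.g
  locallyLipschitz_f := S.locallyLipschitz_f
  locallyLipschitz_g := S.locallyLipschitz_g

/-- Two systems, possibly with different index sets, represent the same multifunction. -/
def IsEquivalent {κ : Type*} (R : AffineSystem D H κ) (S : AffineSystem D H ι) : Prop :=
  ∀ p : D, R.feasible p = S.feasible p

/-- The index set `K` is admissible for the representation of `v₀ - x₀` at `p₀`: `K` consists of
active inequality indices, the vectors `g i p₀`, `i ∈ eqs ∪ K`, are linearly independent and
`v₀ - x₀` is a combination of them whose coefficients with index in `K` are positive. -/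
def RepresentedBy [DecidableEq ι] (S : AffineSystem D H ι) (p₀ : D) (v₀ x₀ : H)
    (K : Finset ι) : Prop :=
  (K : Set ι) ⊆ S.activeIneq p₀ x₀ ∧
  LinearIndepOn ℝ (fun i => S.g i p₀) (↑(S.eqs ∪ K) : Set ι) ∧
  ∃ c : ι → ℝ, (∀ i ∈ K, 0 < c i) ∧ v₀ - x₀ = ∑ i ∈ S.eqs ∪ K, c i • S.g i p₀

/-- The system is a stable representation of its multifunction at `(p₀, v₀, x₀)`, where `x₀` is
feasible for `p₀` and `v₀` is not: there is an admissible `K` such that `x₀` belongs to the lower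
Kuratowski limit at `p₀` of the multifunction given by the system tightened along `K ∪ L`, for each
set `L` of further active inequality indices for which the vectors `g i p₀`, `i ∈ eqs ∪ K ∪ L`, are
linearly independent. -/
def IsStableAt [DecidableEq ι] (S : AffineSystem D H ι) (p₀ : D) (v₀ x₀ : H) : Prop :=
  ∃ K : Finset ι, S.RepresentedBy p₀ v₀ x₀ K ∧
    ∀ L : Finset ι, (L : Set ι) ⊆ S.activeIneq p₀ x₀ \ (K : Set ι) →
      LinearIndepOn ℝ (fun i => S.g i p₀) (↑(S.eqs ∪ K ∪ L) : Set ι) →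
      MemKuratowskiLiminf (S.tighten (K ∪ L)).feasible p₀ x₀

end

end AffineSystem

/-! A pair `(x, x')` lies in `Gr(p)` exactly when `x` is the projection of `v = x + x'` onto `C(p)`.
For `(p, v)` near `(p₀, v₀)`, project `v` onto the smaller set where the constraints in `K` are
equalities. KKT with independent gradients writes the residual over `eqs ∪ K ∪ L` with bounded
multipliers; those on `K` are close to the given positive ones, so they are nonnegative and the
projection onto the smaller set is the one onto `C(p)` (`RCRCQ.eventually_exists_multiplier`). Hence
`x` lies in the set tightened along `K ∪ L`, which is Lipschitz-like by RCRCQ and the lower limit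
hypothesis (`RCRCQ.exists_eventually_feasible_near`). This gives a nearby `y` for the parameter `q`.
Keeping the multipliers and replacing the gradients at `p` by those at `q` gives `y'`, normal to
`C(q)` at `y` because the constraints in `K ∪ L` are active there. RCRCQ carries linear independence
between `p` and `p₀`; finitely many index sets then make all multiplier bounds uniform. -/

/-! ### Finitely generated cones: Carathéodory, closedness, Farkas. -/

section ConicCombinations

variable {H : Type*} [NormedAddCommGroup H] [InnerProductSpace ℝ H] {κ : Type*}

theorem exists_forall_abs_le_mul_norm_sum {g : κ → H} {J : Finset κ}
    (hJ : LinearIndepOn ℝ g (J : Set κ)) :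
    ∃ C : ℝ, 0 < C ∧ ∀ c : κ → ℝ, ∀ i ∈ J, |c i| ≤ C * ‖∑ i ∈ J, c i • g i‖ := by
  have hker : LinearMap.ker (Fintype.linearCombination ℝ (fun i : J => g i)) = ⊥ := by
    rw [LinearMap.ker_eq_bot]
    exact linearIndependent_iff_injective_fintypeLinearCombination.1 hJ
  obtain ⟨C, hC, hanti⟩ := LinearMap.exists_antilipschitzWith _ hker
  refine ⟨C, hC, fun c i hi => ?_⟩
  have h1 := hanti.le_mul_norm (map_zero _)
    (fun i : J => c i)
  rw [Fintype.linearCombination_apply] at h1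
  rw [← Finset.sum_coe_sort J]
  exact (norm_le_pi_norm (fun i : J => c i) ⟨i, hi⟩).trans h1

variable [DecidableEq κ]

/-- The combinations of the vectors `g i`, `i ∈ E ∪ M`, with nonnegative coefficients on `M`. -/
def mixedCone (g : κ → H) (E M : Finset κ) : Set H :=
  {h | ∃ c : κ → ℝ, (∀ i ∈ M, 0 ≤ c i) ∧ h = ∑ i ∈ E ∪ M, c i • g i}

theorem zero_mem_mixedCone (g : κ → H) (E M : Finset κ) : (0 : H) ∈ mixedCone g E M :=
  ⟨0, by simp, by simp⟩

theorem add_mem_mixedCone {g : κ → H} {E M : Finset κ} {x y : H} (hx : x ∈ mixedCone g E M)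
    (hy : y ∈ mixedCone g E M) : x + y ∈ mixedCone g E M := by
  obtain ⟨c, hc, rfl⟩ := hx
  obtain ⟨d, hd, rfl⟩ := hy
  exact ⟨c + d, fun i hi => add_nonneg (hc i hi) (hd i hi), by
    simp [add_smul, Finset.sum_add_distrib]⟩

theorem smul_mem_mixedCone {g : κ → H} {E M : Finset κ} {x : H} {t : ℝ} (ht : 0 ≤ t)
    (hx : x ∈ mixedCone g E M) : t • x ∈ mixedCone g E M := by
  obtain ⟨c, hc, rfl⟩ := hx
  exact ⟨t • c, fun i hi => mul_nonneg ht (hc i hi), by simp [Finset.smul_sum, smul_smul]⟩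

theorem convex_mixedCone (g : κ → H) (E M : Finset κ) : Convex ℝ (mixedCone g E M) :=
  fun _ hx _ hy _ _ ha hb _ =>
    add_mem_mixedCone (smul_mem_mixedCone ha hx) (smul_mem_mixedCone hb hy)

theorem smul_mem_mixedCone_of_mem {g : κ → H} {E M : Finset κ} {i : κ} (hi : i ∈ E ∪ M) {t : ℝ}
    (ht : i ∈ M → 0 ≤ t) : t • g i ∈ mixedCone g E M := by
  refine ⟨Pi.single i t, fun j hj => ?_, ?_⟩
  · by_cases h : j = i
    · subst h; simpa using ht hj
    · simp [h]
  · rw [Finset.sum_eq_single i]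
    · simp
    · intro j _ hj; simp [hj]
    · exact fun h => absurd hi h

theorem mixedCone_mono {g : κ → H} {E M N : Finset κ} (hMN : M ⊆ N) (hE : Disjoint E N) :
    mixedCone g E M ⊆ mixedCone g E N := by
  rintro _ ⟨c, hc, rfl⟩
  refine ⟨fun i => if i ∈ E ∪ M then c i else 0, fun i _ => ?_, ?_⟩
  · have := Finset.disjoint_right.1 hE ‹i ∈ N›
    by_cases hM : i ∈ M
    · simp [hM, hc i hM]
    · simp [hM, this]
  · rw [← Finset.sum_subset (Finset.union_subset_union_right hMN : E ∪ M ⊆ E ∪ N)]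
    · exact Finset.sum_congr rfl fun i hi => by simp only [if_pos hi]
    · intro i _ hi; simp only [if_neg hi, zero_smul]

/-- Conic Carathéodory theorem, where the vectors with free coefficients are kept. -/
theorem exists_linearIndepOn_of_mem_mixedCone {g : κ → H} {E : Finset κ}
    (hE : LinearIndepOn ℝ g (E : Set κ)) {h : H} (M : Finset κ) (hEM : Disjoint E M)
    (hh : h ∈ mixedCone g E M) :
    ∃ N ⊆ M, LinearIndepOn ℝ g (↑(E ∪ N) : Set κ) ∧
      ∃ c : κ → ℝ, (∀ i ∈ N, 0 < c i) ∧ h = ∑ i ∈ E ∪ N, c i • g i := by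
  induction M using Finset.strongInduction with
  | H M ih =>
  obtain ⟨c, hc, rfl⟩ := hh
  have key : ∀ d : κ → ℝ, (∀ i ∈ M, 0 ≤ d i) → (∃ i ∈ M, d i = 0) →
      ∑ i ∈ E ∪ M, c i • g i = ∑ i ∈ E ∪ M, d i • g i →
      ∃ N ⊆ M, LinearIndepOn ℝ g (↑(E ∪ N) : Set κ) ∧
        ∃ c' : κ → ℝ, (∀ i ∈ N, 0 < c' i) ∧
          ∑ i ∈ E ∪ M, c i • g i = ∑ i ∈ E ∪ N, c' i • g i := by
    rintro d hd ⟨j, hj, hdj⟩ hcd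
    obtain ⟨N, hN, h1, h2⟩ := ih (M.erase j) (Finset.erase_ssubset hj)
      (hEM.mono_right (Finset.erase_subset _ _))
      ⟨d, fun i hi => hd i (Finset.mem_of_mem_erase hi), by
        rw [hcd]
        symm
        apply Finset.sum_subset (Finset.union_subset_union_right (Finset.erase_subset _ _))
        intro i hi hi'
        have : i = j := by
          simp only [Finset.mem_union, Finset.mem_erase] at hi hi'
          tauto
        rw [this, hdj, zero_smul]⟩
    exact ⟨N, hN.trans (Finset.erase_subset _ _), h1, h2⟩
  by_cases hz : ∃ i ∈ M, c i = 0
  · exact key c hc hz rfl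
  by_cases hind : LinearIndepOn ℝ g (↑(E ∪ M) : Set κ)
  · refine ⟨M, subset_rfl, hind, c, fun i hi => ?_, rfl⟩
    exact lt_of_le_of_ne (hc i hi) fun h => hz ⟨i, hi, h.symm⟩
  -- Since `E` is independent, a nontrivial relation must involve an index of `M`; its sign can be
  -- chosen.
  have hrel : ∃ a : κ → ℝ, ∑ i ∈ E ∪ M, a i • g i = 0 ∧ ∃ j ∈ M, 0 < a j := by
    rw [linearIndepOn_finset_iff] at hind
    push Not at hind
    obtain ⟨a, ha, k, hk, hak⟩ := hind
    have : ∃ j ∈ M, a j ≠ 0 := by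
      by_contra! hM
      have hsum : ∑ i ∈ E, a i • g i = 0 := by
        rw [← ha]
        apply Finset.sum_subset Finset.subset_union_left
        intro i hi hi'
        rw [hM i ((Finset.mem_union.1 hi).resolve_left hi'), zero_smul]
      rcases Finset.mem_union.1 hk with hk | hk
      · exact hak (linearIndepOn_finset_iff.1 hE a hsum k hk)
      · exact hak (hM k hk)
    obtain ⟨j, hj, haj⟩ := this
    rcases lt_or_gt_of_ne haj with h | h
    · exact ⟨-a, by simp [ha], j, hj, by simpa using h⟩
    · exact ⟨a, ha, j, hj, h⟩
  obtain ⟨a, ha, j, hj, haj⟩ := hrel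
  obtain ⟨k, hk, hmin⟩ := Finset.exists_min_image (M.filter fun i => 0 < a i) (fun i => c i / a i)
    ⟨j, Finset.mem_filter.2 ⟨hj, haj⟩⟩
  rw [Finset.mem_filter] at hk
  -- Subtracting the relation with the minimal ratio `c k / a k` keeps all coefficients on `M`
  -- nonnegative and makes the one at `k` vanish.
  refine key (fun i => c i - c k / a k * a i) (fun i hi => ?_) ⟨k, hk.1, ?_⟩ ?_
  · rcases lt_or_ge 0 (a i) with hai | hai
    · have := hmin i (Finset.mem_filter.2 ⟨hi, hai⟩)
      rw [le_div_iff₀ hai] at this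
      linarith
    · have := mul_nonpos_of_nonneg_of_nonpos (div_nonneg (hc k hk.1) hk.2.le) hai
      linarith [hc i hi]
  · have := hk.2.ne'
    field_simp
    simp
  · simp only [sub_smul, Finset.sum_sub_distrib, mul_smul, ← Finset.smul_sum, ha]
    simp

/-- An injective linear map from a finite-dimensional space is a closed embedding, and the cone is
the image of a closed set of coefficients. -/
theorem isClosed_mixedCone_of_linearIndepOn {g : κ → H} {E M : Finset κ}
    (h : LinearIndepOn ℝ g (↑(E ∪ M) : Set κ)) : IsClosed (mixedCone g E M) := by
  have hinj : Function.Injective (Fintype.linearCombination ℝ (fun i : ↥(E ∪ M) => g i)) :=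
    linearIndependent_iff_injective_fintypeLinearCombination.1 h
  have hclosed : IsClosed {c : ↥(E ∪ M) → ℝ | ∀ i : ↥(E ∪ M), (i : κ) ∈ M → 0 ≤ c i} := by
    simp only [Set.ofPred_forall]
    exact isClosed_iInter fun i => isClosed_iInter fun _ =>
      isClosed_le continuous_const (continuous_apply i)
  have := (LinearMap.isClosedEmbedding_of_injective (LinearMap.ker_eq_bot.2 hinj)).isClosedMap _
    hclosed
  convert this using 1
  ext x
  constructor
  · rintro ⟨c, hc, rfl⟩
    refine ⟨fun i => c i, fun i hi => hc i hi, ?_⟩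
    rw [Fintype.linearCombination_apply, ← Finset.sum_coe_sort (E ∪ M)]
  · rintro ⟨c, hc, rfl⟩
    refine ⟨fun i => if hi : i ∈ E ∪ M then c ⟨i, hi⟩ else 0, fun i hi => ?_, ?_⟩
    · have hi' : i ∈ E ∪ M := Finset.mem_union_right _ hi
      simp only [hi', dif_pos]
      exact hc ⟨i, hi'⟩ hi
    · rw [Fintype.linearCombination_apply, ← Finset.sum_coe_sort (E ∪ M)]
      exact Finset.sum_congr rfl fun i _ => by simp only [dif_pos i.2]

/-- By Carathéodory the cone is a finite union of cones with independent generators. -/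
theorem isClosed_mixedCone {g : κ → H} {E M : Finset κ} (hE : LinearIndepOn ℝ g (E : Set κ))
    (hEM : Disjoint E M) : IsClosed (mixedCone g E M) := by
  have : mixedCone g E M = ⋃ N ∈ {N : Finset κ | N ⊆ M ∧ LinearIndepOn ℝ g (↑(E ∪ N) : Set κ)},
      mixedCone g E N := by
    ext x
    simp only [Set.mem_iUnion, Set.mem_ofPred_eq]
    constructor
    · intro hx
      obtain ⟨N, hN, h1, c, hc, h2⟩ := exists_linearIndepOn_of_mem_mixedCone hE M hEM hx
      exact ⟨N, ⟨hN, h1⟩, c, fun i hi => (hc i hi).le, h2⟩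
    · rintro ⟨N, ⟨hN, -⟩, hx⟩
      exact mixedCone_mono hN hEM hx
  rw [this]
  refine Set.Finite.isClosed_biUnion ?_ fun N hN => isClosed_mixedCone_of_linearIndepOn hN.2
  exact (Finset.finite_toSet M.powerset).subset fun N hN => by simpa using hN.1

/-- Farkas' lemma. -/
theorem mem_mixedCone_of_forall_inner_nonpos [CompleteSpace H] {g : κ → H} {E M : Finset κ}
    (hE : LinearIndepOn ℝ g (E : Set κ)) (hEM : Disjoint E M) {h : H}
    (hh : ∀ d : H, (∀ i ∈ E, inner ℝ d (g i) = 0) → (∀ i ∈ M, inner ℝ d (g i) ≤ 0) →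
      inner ℝ h d ≤ 0) : h ∈ mixedCone g E M := by
  obtain ⟨n, hn, hmin⟩ := exists_norm_eq_iInf_of_complete_convex ⟨0, zero_mem_mixedCone g E M⟩
    (isClosed_mixedCone hE hEM).isComplete (convex_mixedCone g E M) h
  rw [norm_eq_iInf_iff_real_inner_le_zero (convex_mixedCone g E M) hn] at hmin
  have hle : ∀ w ∈ mixedCone g E M, inner ℝ (h - n) w ≤ 0 := fun w hw => by
    simpa using hmin (n + w) (add_mem_mixedCone hn hw)
  have hnn : 0 ≤ inner ℝ (h - n) n := by simpa using hmin 0 (zero_mem_mixedCone g E M)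
  -- With `n` the projection of `h` onto the cone, `h - n` is an admissible test direction, which
  -- forces `‖h - n‖² ≤ 0`.
  have hd := hh (h - n) (fun i hi => ?_) (fun i hi => ?_)
  · have : inner ℝ (h - n) (h - n) ≤ 0 := by
      rw [inner_sub_right (h - n) h n, real_inner_comm]
      linarith
    rw [real_inner_self_nonpos, sub_eq_zero] at this
    rwa [this]
  · have hnot : i ∉ M := Finset.disjoint_left.1 hEM hi
    have h1 := hle _ (smul_mem_mixedCone_of_mem (Finset.mem_union_left M hi) (t := 1)
      fun h => absurd h hnot)
    have h2 := hle _ (smul_mem_mixedCone_of_mem (Finset.mem_union_left M hi) (t := -1)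
      fun h => absurd h hnot)
    simp at h1 h2
    linarith
  · simpa using hle _ (smul_mem_mixedCone_of_mem (Finset.mem_union_right E hi) (t := 1)
      fun _ => zero_le_one)

end ConicCombinations

/-! ### Metric projections and normal cones. -/

section MetricProjection

variable {H : Type*} [NormedAddCommGroup H] [InnerProductSpace ℝ H] {C : Set H}

theorem isMetricProjection_iff_mem_convexNormalCone (hC : Convex ℝ C) {v x : H} (hx : x ∈ C) :
    IsMetricProjection C v x ↔ v - x ∈ convexNormalCone C x := by
  rw [convexNormalCone, Set.mem_ofPred_eq, ← norm_eq_iInf_iff_real_inner_le_zero hC hx]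
  have hbdd : BddBelow (Set.range fun w : C => ‖v - w‖) :=
    ⟨0, by rintro _ ⟨w, rfl⟩; exact norm_nonneg _⟩
  have : Nonempty C := ⟨⟨x, hx⟩⟩
  constructor
  · exact fun h => le_antisymm (le_ciInf fun w => h.2 w w.2) (ciInf_le hbdd ⟨x, hx⟩)
  · exact fun h => ⟨hx, fun y hy => h.le.trans (ciInf_le hbdd ⟨y, hy⟩)⟩

theorem exists_isMetricProjection [CompleteSpace H] (hC : Convex ℝ C) (hclosed : IsClosed C)
    (hne : C.Nonempty) (v : H) : ∃ x, IsMetricProjection C v x := by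
  obtain ⟨x, hx, h⟩ := exists_norm_eq_iInf_of_complete_convex hne hclosed.isComplete hC v
  rw [norm_eq_iInf_iff_real_inner_le_zero hC hx] at h
  exact ⟨x, (isMetricProjection_iff_mem_convexNormalCone hC hx).2 h⟩

/-- Adding the two normal cone inequalities gives `‖x - y‖² ≤ 0`. -/
theorem eq_of_sub_mem_convexNormalCone {v x y : H} (hx : x ∈ C) (hy : y ∈ C)
    (hvx : v - x ∈ convexNormalCone C x) (hvy : v - y ∈ convexNormalCone C y) : x = y := by
  have h1 := hvx y hy
  have h2 := hvy x hx
  have h3 : inner ℝ (x - y) (x - y) ≤ 0 := by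
    have : inner ℝ (x - y) (x - y) = inner ℝ (v - x) (y - x) + inner ℝ (v - y) (x - y) := by
      rw [← neg_sub x y, inner_neg_right, neg_add_eq_sub, ← inner_sub_left]
      congr 1; abel
    linarith
  rwa [real_inner_self_nonpos, sub_eq_zero] at h3

end MetricProjection

/-! ### Multipliers and linear independence under perturbation of the parameter. -/

namespace AffineSystem

variable {G : Type*} [NormedAddCommGroup G] {D : Set G}
  {H : Type*} [NormedAddCommGroup H] {κ : Type*}

theorem continuous_f (S : AffineSystem D H κ) (i : κ) : Continuous (S.f i) :=
  (S.locallyLipschitz_f i).continuous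

theorem continuous_g (S : AffineSystem D H κ) (i : κ) : Continuous (S.g i) :=
  (S.locallyLipschitz_g i).continuous

theorem exists_lipschitzOn_nhds [Finite κ] (S : AffineSystem D H κ) (p₀ : D) :
    ∃ k : ℝ, 0 ≤ k ∧ ∃ U ∈ 𝓝 p₀, ∀ p ∈ U, ∀ q ∈ U, ∀ i,
      |S.f i p - S.f i q| ≤ k * ‖(p : G) - q‖ ∧ ‖S.g i p - S.g i q‖ ≤ k * ‖(p : G) - q‖ := by
  have := Fintype.ofFinite κ
  choose kf Uf hUf hf using fun i => S.locallyLipschitz_f i p₀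
  choose kg Ug hUg hg using fun i => S.locallyLipschitz_g i p₀
  refine ⟨∑ i, ((kf i : ℝ) + kg i), by positivity, ⋂ i, Uf i ∩ Ug i,
    Filter.iInter_mem.2 fun i => Filter.inter_mem (hUf i) (hUg i), fun p hp q hq i => ?_⟩
  have hk : (kf i : ℝ) + kg i ≤ ∑ i, ((kf i : ℝ) + kg i) :=
    Finset.single_le_sum (f := fun i => (kf i : ℝ) + kg i) (fun i _ => by positivity)
      (Finset.mem_univ i)
  have hkf : (kf i : ℝ) ≤ ∑ i, ((kf i : ℝ) + kg i) := le_trans (by simp) hk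
  have hkg : (kg i : ℝ) ≤ ∑ i, ((kf i : ℝ) + kg i) := le_trans (by simp) hk
  have hp' := Set.mem_iInter.1 hp i
  have hq' := Set.mem_iInter.1 hq i
  have h1 := (hf i).dist_le_mul p hp'.1 q hq'.1
  have h2 := (hg i).dist_le_mul p hp'.2 q hq'.2
  rw [Subtype.dist_eq, dist_eq_norm, dist_eq_norm] at h1 h2
  exact ⟨h1.trans (by gcongr), h2.trans (by gcongr)⟩

variable [InnerProductSpace ℝ H]

theorem convex_feasible (S : AffineSystem D H κ) (p : D) : Convex ℝ (S.feasible p) := by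
  rintro x ⟨hx1, hx2⟩ y ⟨hy1, hy2⟩ a b ha hb hab
  refine ⟨fun i hi => ?_, fun i hi => ?_⟩
  · rw [inner_add_left, real_inner_smul_left, real_inner_smul_left, hx1 i hi, hy1 i hi,
      ← add_mul, hab, one_mul]
  · rw [inner_add_left, real_inner_smul_left, real_inner_smul_left]
    calc a * inner ℝ x (S.g i p) + b * inner ℝ y (S.g i p)
        ≤ a * S.f i p + b * S.f i p := by gcongr <;> simp_all
      _ = S.f i p := by rw [← add_mul, hab, one_mul]

theorem isClosed_feasible (S : AffineSystem D H κ) (p : D) : IsClosed (S.feasible p) := by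
  have : S.feasible p = (⋂ i ∈ S.eqs, {x | inner ℝ x (S.g i p) = S.f i p}) ∩
      ⋂ i ∉ S.eqs, {x | inner ℝ x (S.g i p) ≤ S.f i p} := by
    ext x; simp [feasible]
  rw [this]
  refine IsClosed.inter ?_ ?_
  · exact isClosed_iInter fun i => isClosed_iInter fun _ =>
      isClosed_eq (by fun_prop) continuous_const
  · exact isClosed_iInter fun i => isClosed_iInter fun _ =>
      isClosed_le (by fun_prop) continuous_const

theorem inner_le_of_mem_feasible {S : AffineSystem D H κ} {p : D} {x : H} (hx : x ∈ S.feasible p)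
    (i : κ) : inner ℝ x (S.g i p) ≤ S.f i p := by
  by_cases hi : i ∈ S.eqs
  · exact (hx.1 i hi).le
  · exact hx.2 i hi

theorem sum_mem_convexNormalCone [DecidableEq κ] {S : AffineSystem D H κ} {p : D} {x : H}
    (hx : x ∈ S.feasible p) {M : Finset κ} (hM : (M : Set κ) ⊆ S.active p x) {c : κ → ℝ}
    (hc : ∀ i ∈ M, 0 ≤ c i) :
    ∑ i ∈ S.eqs ∪ M, c i • S.g i p ∈ convexNormalCone (S.feasible p) x := by
  intro y hy
  rw [sum_inner]
  refine Finset.sum_nonpos fun i hi => ?_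
  rw [real_inner_smul_left, real_inner_comm, inner_sub_left]
  by_cases hiE : i ∈ S.eqs
  · rw [hx.1 i hiE, hy.1 i hiE, sub_self, mul_zero]
  · have hiM : i ∈ M := (Finset.mem_union.1 hi).resolve_left hiE
    have h1 : inner ℝ x (S.g i p) = S.f i p := hM hiM
    rw [h1]
    exact mul_nonpos_of_nonneg_of_nonpos (hc i hiM)
      (sub_nonpos.2 (inner_le_of_mem_feasible hy i))

/-- Karush-Kuhn-Tucker conditions, with linearly independent gradients. -/
theorem exists_representedBy [CompleteSpace H] [Finite κ] [DecidableEq κ]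
    {S : AffineSystem D H κ} {p : D} {v x : H} (hx : x ∈ S.feasible p)
    (hv : v - x ∈ convexNormalCone (S.feasible p) x)
    (hE : LinearIndepOn ℝ (fun i => S.g i p) (S.eqs : Set κ)) :
    ∃ M, S.RepresentedBy p v x M := by
  classical
  have := Fintype.ofFinite κ
  let A : Finset κ := {i | i ∈ S.activeIneq p x}
  have hEA : Disjoint S.eqs A :=
    Finset.disjoint_left.2 fun i hi hiA => (Finset.mem_filter.1 hiA).2.1 hi
  have hmem : v - x ∈ mixedCone (fun i => S.g i p) S.eqs A := by
    refine mem_mixedCone_of_forall_inner_nonpos hE hEA fun d hdE hdA => ?_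
    -- By Farkas it suffices that `d` is a feasible direction: inactive constraints have slack for
    -- small `t`.
    have hsmall : ∀ᶠ t : ℝ in 𝓝[>] 0, x + t • d ∈ S.feasible p := by
      have hineq : ∀ᶠ t : ℝ in 𝓝[>] 0, ∀ i ∉ S.eqs, inner ℝ (x + t • d) (S.g i p) ≤ S.f i p := by
        refine Filter.eventually_all.2 fun i => ?_
        by_cases hiE : i ∈ S.eqs
        · simp [hiE]
        rcases (inner_le_of_mem_feasible hx i).lt_or_eq with hlt | heq
        · have hcont : Continuous fun t : ℝ => inner ℝ (x + t • d) (S.g i p) := by fun_prop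
          have := hcont.continuousAt.eventually_lt (continuousAt_const (x := (0 : ℝ)))
            (by simpa using hlt)
          filter_upwards [nhdsWithin_le_nhds this] with t ht _ using ht.le
        · have hiA : i ∈ A := Finset.mem_filter.2 ⟨Finset.mem_univ i, hiE, heq⟩
          filter_upwards [self_mem_nhdsWithin] with t ht _
          rw [inner_add_left, real_inner_smul_left, heq]
          have := mul_nonpos_of_nonneg_of_nonpos (le_of_lt ht) (hdA i hiA)
          linarith
      filter_upwards [hineq] with t ht
      refine ⟨fun i hi => ?_, ht⟩
      rw [inner_add_left, real_inner_smul_left, hdE i hi, mul_zero, add_zero, hx.1 i hi]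
    obtain ⟨t, ht, htpos⟩ := (hsmall.and self_mem_nhdsWithin).exists
    have := hv _ ht
    rw [add_sub_cancel_left, real_inner_smul_right] at this
    exact nonpos_of_mul_nonpos_right this htpos
  obtain ⟨N, hN, hind, c, hc, hsum⟩ := exists_linearIndepOn_of_mem_mixedCone hE A hEA hmem
  exact ⟨N, fun i hi => (Finset.mem_filter.1 (hN hi)).2, hind, c, hc, hsum⟩

/-- Near `(p₀, x₀)` only constraints that are active at `(p₀, x₀)` are active. -/
theorem exists_eventually_active_subset [Finite κ] (S : AffineSystem D H κ) (p₀ : D) (x₀ : H) :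
    ∃ δ > 0, ∀ᶠ p in 𝓝 p₀, ∀ x, ‖x - x₀‖ < δ → S.active p x ⊆ S.active p₀ x₀ := by
  have h : ∀ᶠ z : D × H in 𝓝 (p₀, x₀), ∀ i, i ∉ S.active p₀ x₀ → i ∉ S.active z.1 z.2 := by
    refine Filter.eventually_all.2 fun i => ?_
    by_cases hi : i ∈ S.active p₀ x₀
    · simp [hi]
    have hc1 : Continuous fun z : D × H => inner ℝ z.2 (S.g i z.1) :=
      continuous_snd.inner ((S.continuous_g i).comp continuous_fst)
    have hc2 : Continuous fun z : D × H => S.f i z.1 := (S.continuous_f i).comp continuous_fst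
    filter_upwards [(isOpen_ne_fun hc1 hc2).mem_nhds hi] with z hz _ using hz
  rw [nhds_prod_eq, Filter.eventually_prod_iff] at h
  obtain ⟨P, hP, Q, hQ, hPQ⟩ := h
  obtain ⟨δ, hδ, hball⟩ := Metric.eventually_nhds_iff.1 hQ
  refine ⟨δ, hδ, hP.mono fun p hp x hx i hi => ?_⟩
  by_contra hn
  exact hPQ hp (hball (by rwa [dist_eq_norm])) i hn hi

/-- Applied to the largest coefficient, the bound at `p₀` loses at most half of it once the
gradients have moved by less than `1 / (2 * C)` in total; hence the constant `2 * C`. -/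
theorem exists_eventually_forall_abs_le [Finite κ] (S : AffineSystem D H κ) {p₀ : D}
    {J : Finset κ} (hJ : LinearIndepOn ℝ (fun i => S.g i p₀) (J : Set κ)) :
    ∃ C : ℝ, 0 < C ∧ ∀ᶠ p in 𝓝 p₀, ∀ c : κ → ℝ, ∀ i ∈ J,
      |c i| ≤ C * ‖∑ i ∈ J, c i • S.g i p‖ := by
  obtain ⟨C, hC, hbound⟩ := exists_forall_abs_le_mul_norm_sum hJ
  refine ⟨2 * C, by positivity, ?_⟩
  have hcont : Continuous fun p => ∑ i ∈ J, ‖S.g i p₀ - S.g i p‖ :=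
    continuous_finsetSum _ fun i _ => (continuous_const.sub (S.continuous_g i)).norm
  have hev := hcont.continuousAt.eventually_lt (continuousAt_const (x := p₀) (y := 1 / (2 * C)))
    (by simpa using hC)
  filter_upwards [hev] with p hp c i hi
  obtain ⟨k, hk, hmax⟩ := J.exists_max_image (fun i => |c i|) ⟨i, hi⟩
  refine (hmax i hi).trans ?_
  have h1 := hbound c k hk
  have h2 : ∑ i ∈ J, c i • S.g i p₀ =
      ∑ i ∈ J, c i • S.g i p + ∑ i ∈ J, c i • (S.g i p₀ - S.g i p) := by
    rw [← Finset.sum_add_distrib]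
    exact Finset.sum_congr rfl fun i _ => by rw [← smul_add]; congr 1; abel
  have h3 : ‖∑ i ∈ J, c i • (S.g i p₀ - S.g i p)‖ ≤ |c k| * (1 / (2 * C)) := by
    calc ‖∑ i ∈ J, c i • (S.g i p₀ - S.g i p)‖
        ≤ ∑ i ∈ J, |c k| * ‖S.g i p₀ - S.g i p‖ := norm_sum_le_of_le _ fun i hi => by
          rw [norm_smul]; exact mul_le_mul_of_nonneg_right (hmax i hi) (norm_nonneg _)
      _ = |c k| * ∑ i ∈ J, ‖S.g i p₀ - S.g i p‖ := (Finset.mul_sum _ _ _).symm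
      _ ≤ _ := by gcongr
  have h4 : C * ‖∑ i ∈ J, c i • S.g i p₀‖ ≤
      C * (‖∑ i ∈ J, c i • S.g i p‖ + |c k| * (1 / (2 * C))) := by
    rw [h2]
    gcongr
    exact (norm_add_le _ _).trans (by gcongr)
  have h5 : C * (|c k| * (1 / (2 * C))) = |c k| / 2 := by field_simp
  linarith


theorem exists_eventually_forall_linearIndepOn_abs_le [Finite κ] (S : AffineSystem D H κ)
    (p₀ : D) : ∃ C : ℝ, 0 < C ∧ ∀ᶠ p in 𝓝 p₀, ∀ J : Finset κ,
      LinearIndepOn ℝ (fun i => S.g i p₀) (J : Set κ) →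
        ∀ c : κ → ℝ, ∀ i ∈ J, |c i| ≤ C * ‖∑ i ∈ J, c i • S.g i p‖ := by
  have := Fintype.ofFinite κ
  have hex : ∀ J : Finset κ, ∃ C : ℝ, 0 < C ∧ ∀ᶠ p in 𝓝 p₀,
      LinearIndepOn ℝ (fun i => S.g i p₀) (J : Set κ) →
        ∀ c : κ → ℝ, ∀ i ∈ J, |c i| ≤ C * ‖∑ i ∈ J, c i • S.g i p‖ := fun J => by
    by_cases hJ : LinearIndepOn ℝ (fun i => S.g i p₀) (J : Set κ)
    · obtain ⟨C, hC, h⟩ := S.exists_eventually_forall_abs_le hJ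
      exact ⟨C, hC, h.mono fun p hp _ => hp⟩
    · exact ⟨1, one_pos, by simp [hJ]⟩
  choose C hC hev using hex
  refine ⟨∑ J, C J, Finset.sum_pos (fun J _ => hC J) Finset.univ_nonempty, ?_⟩
  filter_upwards [Filter.eventually_all.2 hev] with p hp J hJ c i hi
  refine (hp J hJ c i hi).trans ?_
  gcongr
  exact Finset.single_le_sum (fun J _ => (hC J).le) (Finset.mem_univ J)

/-- Independence of a finite family says that its rank is its cardinality, and RCRCQ keeps the rank
constant. -/
theorem RCRCQ.eventually_linearIndepOn [Finite κ] {S : AffineSystem D H κ} {p₀ : D} {x₀ : H}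
    (h : S.RCRCQ p₀ x₀) : ∀ᶠ p in 𝓝 p₀, ∀ J : Finset κ, S.eqs ⊆ J → (J : Set κ) ⊆ S.active p₀ x₀ →
      (LinearIndepOn ℝ (fun i => S.g i p) (J : Set κ) ↔
        LinearIndepOn ℝ (fun i => S.g i p₀) (J : Set κ)) := by
  obtain ⟨U, hU, hrank⟩ := h
  filter_upwards [hU] with p hp J hEJ hJ
  have key : ∀ q, LinearIndepOn ℝ (fun i => S.g i q) (J : Set κ) ↔
      Fintype.card J = Set.finrank ℝ ((fun i => S.g i q) '' J) := fun q => by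
    have : (fun i => S.g i q) '' J = Set.range fun i : J => S.g i q := Set.image_eq_range _ _
    rw [this, ← linearIndependent_iff_card_eq_finrank_span]
    rfl
  rw [key, key, hrank J (by exact_mod_cast hEJ) hJ p hp]

theorem RCRCQ.tighten [DecidableEq κ] {S : AffineSystem D H κ} {p₀ : D} {x₀ : H}
    (h : S.RCRCQ p₀ x₀) (J : Finset κ) : (S.tighten J).RCRCQ p₀ x₀ := by
  obtain ⟨U, hU, hrank⟩ := h
  exact ⟨U, hU, fun J' h1 h2 => hrank J' (fun i hi => h1 (by
    simpa [AffineSystem.tighten] using Or.inl hi)) h2⟩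

end AffineSystem

/-! ### Lipschitz behaviour of the feasible sets, and local description of the projection. -/

namespace AffineSystem

variable {G : Type*} [NormedAddCommGroup G] {D : Set G}
  {H : Type*} [NormedAddCommGroup H] [InnerProductSpace ℝ H] {κ : Type*}

theorem eventually_exists_mem_feasible {S : AffineSystem D H κ} {p₀ : D} {x₀ : H}
    (h : MemKuratowskiLiminf S.feasible p₀ x₀) {ε : ℝ} (hε : 0 < ε) :
    ∀ᶠ p in 𝓝 p₀, ∃ z ∈ S.feasible p, ‖z - x₀‖ < ε := by
  obtain ⟨U, hU, hne⟩ := h _ (Metric.ball_mem_nhds x₀ hε)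
  filter_upwards [hU] with p hp
  obtain ⟨z, hz, hzp⟩ := hne p hp
  exact ⟨z, hzp, by rwa [← dist_eq_norm]⟩

/-- Under the relaxed constant rank constraint qualification, a system of affine constraints with
independent equality constraints whose lower limit contains `x₀` is Lipschitz-like around
`(p₀, x₀)`. -/
theorem RCRCQ.exists_eventually_feasible_near [CompleteSpace H] [Finite κ]
    {S : AffineSystem D H κ} {p₀ : D} {x₀ : H} (hS : S.RCRCQ p₀ x₀)
    (hE : LinearIndepOn ℝ (fun i => S.g i p₀) (S.eqs : Set κ))
    (hact : (S.eqs : Set κ) ⊆ S.active p₀ x₀)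
    (hlim : MemKuratowskiLiminf S.feasible p₀ x₀) :
    ∃ ℓ : ℝ, 0 ≤ ℓ ∧ ∀ᶠ z : (D × D) × H in 𝓝 ((p₀, p₀), x₀), z.2 ∈ S.feasible z.1.1 →
      ∃ y ∈ S.feasible z.1.2, ‖z.2 - y‖ ≤ ℓ * ‖(z.1.1 : G) - z.1.2‖ := by
  classical
  have := Fintype.ofFinite κ
  obtain ⟨k, hk, U, hU, hlip⟩ := S.exists_lipschitzOn_nhds p₀
  obtain ⟨C, hC, hbound⟩ := S.exists_eventually_forall_linearIndepOn_abs_le p₀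
  obtain ⟨δ, hδ, hactive⟩ := S.exists_eventually_active_subset p₀ x₀
  let N : ℝ := Fintype.card κ
  let B : ℝ := ‖x₀‖ + 2
  refine ⟨N * (C * (k * B)), by positivity, ?_⟩
  have h1 : ∀ᶠ p in 𝓝 p₀, p ∈ U := hU
  have h2 := h1.and ((eventually_exists_mem_feasible hlim (show 0 < δ / 4 by positivity)).and
    (hbound.and (hactive.and hS.eventually_linearIndepOn)))
  have hx : ∀ᶠ x in 𝓝 x₀, ‖x - x₀‖ < min (δ / 4) 1 := by
    filter_upwards [Metric.ball_mem_nhds x₀ (show 0 < min (δ / 4) 1 by positivity)] with x hx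
    rwa [← dist_eq_norm]
  filter_upwards [(h1.prod_nhds h2).prod_nhds hx]
  rintro ⟨⟨p, q⟩, x⟩ ⟨⟨hpU, hqU, ⟨z, hz, hzx⟩, hqbound, hqact, hqind⟩, hxx⟩ hxp
  simp only at *
  have hxδ := hxx.trans_le (min_le_left _ _)
  have hx1 := hxx.trans_le (min_le_right _ _)
  obtain ⟨y, hy⟩ := exists_isMetricProjection (S.convex_feasible q) (S.isClosed_feasible q)
    ⟨z, hz⟩ x
  have hxy : ‖x - y‖ ≤ ‖x - z‖ := hy.2 z hz
  have hyx₀ : ‖y - x₀‖ < δ := by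
    have e1 : ‖x - z‖ ≤ ‖x - x₀‖ + ‖z - x₀‖ := by
      simpa using norm_sub_le (x - x₀) (z - x₀)
    have e2 : ‖y - x₀‖ ≤ ‖x - x₀‖ + ‖x - y‖ := by
      simpa using norm_sub_le (x - x₀) (x - y)
    linarith
  obtain ⟨M, hM, hind, c, hc, hsum⟩ := exists_representedBy hy.1
    ((isMetricProjection_iff_mem_convexNormalCone (S.convex_feasible q) hy.1).1 hy)
    ((hqind S.eqs subset_rfl hact).2 hE)
  have hMact : (M : Set κ) ⊆ S.active p₀ x₀ := fun i hi => hqact y hyx₀ (hM hi).2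
  -- The uniform multiplier bound is available for families independent at `p₀`, so independence is
  -- carried back from `q`.
  have hind₀ := (hqind (S.eqs ∪ M) Finset.subset_union_left (by
    rw [Finset.coe_union]; exact Set.union_subset hact hMact)).1 hind
  have hcb : ∀ i ∈ S.eqs ∪ M, |c i| ≤ C * ‖x - y‖ := fun i hi => by
    rw [hsum]; exact hqbound _ hind₀ c i hi
  refine ⟨y, hy.1, ?_⟩
  let s : ℝ := k * ‖(p : G) - q‖
  have hs : 0 ≤ s := by positivity
  have hB : ‖x‖ + 1 ≤ B := by
    have : ‖x‖ ≤ ‖x - x₀‖ + ‖x₀‖ := by simpa using norm_add_le (x - x₀) x₀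
    simp only [B]; linarith
  -- Residuals of the constraints at `x` change by at most `s * B` from `p` to `q`, so the
  -- feasibility of `x` at `p` limits its violation at `q`.
  have hgap : ∀ i, |(inner ℝ x (S.g i q) - S.f i q) - (inner ℝ x (S.g i p) - S.f i p)| ≤ s * B :=
    fun i => by
      obtain ⟨hf, hg⟩ := hlip p hpU q hqU i
      have e : (inner ℝ x (S.g i q) - S.f i q) - (inner ℝ x (S.g i p) - S.f i p) =
          (S.f i p - S.f i q) - inner ℝ x (S.g i p - S.g i q) := by
        rw [inner_sub_right]; ring
      rw [e]
      calc _ ≤ |S.f i p - S.f i q| + |inner ℝ x (S.g i p - S.g i q)| := abs_sub _ _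
        _ ≤ s + ‖x‖ * s := add_le_add hf ((abs_real_inner_le_norm _ _).trans (by gcongr))
        _ = s * (‖x‖ + 1) := by ring
        _ ≤ s * B := by gcongr
  have hterm : ∀ i ∈ S.eqs ∪ M, c i * inner ℝ (S.g i q) (x - y) ≤ C * ‖x - y‖ * (s * B) := by
    intro i hi
    have hyi : inner ℝ y (S.g i q) = S.f i q := by
      rcases Finset.mem_union.1 hi with h | h
      · exact hy.1.1 i h
      · exact (hM h).2
    rw [real_inner_comm, inner_sub_left, hyi]
    by_cases hiE : i ∈ S.eqs
    · have h0 := hgap i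
      rw [hxp.1 i hiE, sub_self, sub_zero] at h0
      calc _ ≤ |c i * (inner ℝ x (S.g i q) - S.f i q)| := le_abs_self _
        _ = |c i| * |inner ℝ x (S.g i q) - S.f i q| := abs_mul _ _
        _ ≤ _ := by gcongr; exact hcb i hi
    · have hci := hc i ((Finset.mem_union.1 hi).resolve_left hiE)
      have h0 := (abs_le.1 (hgap i)).2
      have h1 := inner_le_of_mem_feasible hxp i
      calc _ ≤ c i * (s * B) := by gcongr; linarith
        _ ≤ _ := by
          have : 0 ≤ s * B := by positivity
          gcongr
          exact (le_abs_self _).trans (hcb i hi)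
  -- The multipliers are themselves of order `‖x - y‖`, so one factor cancels and the estimate is
  -- Lipschitz.
  have hsq : ‖x - y‖ * ‖x - y‖ ≤ ‖x - y‖ * (N * (C * (k * B)) * ‖(p : G) - q‖) := by
    rw [← real_inner_self_eq_norm_mul_norm]
    calc inner ℝ (x - y) (x - y) = inner ℝ (∑ i ∈ S.eqs ∪ M, c i • S.g i q) (x - y) := by
          rw [← hsum]
      _ = ∑ i ∈ S.eqs ∪ M, c i * inner ℝ (S.g i q) (x - y) := by
          simp only [sum_inner, real_inner_smul_left]
      _ ≤ (S.eqs ∪ M).card * (C * ‖x - y‖ * (s * B)) := by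
          rw [← nsmul_eq_mul]; exact Finset.sum_le_card_nsmul _ _ _ hterm
      _ ≤ N * (C * ‖x - y‖ * (s * B)) := by
          have : ((S.eqs ∪ M).card : ℝ) ≤ N := Nat.cast_le.2 (Finset.card_le_univ _)
          gcongr
      _ = _ := by simp only [s]; ring
  rcases (norm_nonneg (x - y)).eq_or_lt with h | h
  · rw [← h]; positivity
  · exact le_of_mul_le_mul_left hsq h

/-- The point of the set tightened along `K` which is closest to `v` is the projection of `v` onto
the feasible set, with multipliers that are bounded and nonnegative on `K`. -/
theorem RCRCQ.eventually_exists_multiplier [CompleteSpace H] [Finite κ] [DecidableEq κ]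
    {R : AffineSystem D H κ} {p₀ : D} {v₀ x₀ : H} (hR : R.RCRCQ p₀ x₀)
    (hx₀ : x₀ ∈ R.feasible p₀) {K : Finset κ} (hK : R.RepresentedBy p₀ v₀ x₀ K)
    (hlim : MemKuratowskiLiminf (R.tighten K).feasible p₀ x₀) :
    ∃ B : ℝ, 0 ≤ B ∧ ∀ᶠ z : D × H in 𝓝 (p₀, v₀), ∃ x ∈ R.feasible z.1, ∃ L : Finset κ,
      (L : Set κ) ⊆ R.activeIneq p₀ x₀ \ (K : Set κ) ∧
      LinearIndepOn ℝ (fun i => R.g i p₀) (↑(R.eqs ∪ K ∪ L) : Set κ) ∧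
      x ∈ (R.tighten (K ∪ L)).feasible z.1 ∧ ∃ c : κ → ℝ, (∀ i ∈ K ∪ L, 0 ≤ c i) ∧
        (∀ i ∈ R.eqs ∪ (K ∪ L), |c i| ≤ B) ∧
        z.2 - x = ∑ i ∈ R.eqs ∪ (K ∪ L), c i • R.g i z.1 := by
  obtain ⟨hKact, hKind, lam, hlam, hlamsum⟩ := hK
  have hEact : (↑(R.eqs ∪ K) : Set κ) ⊆ R.active p₀ x₀ := by
    rw [Finset.coe_union]
    exact Set.union_subset (fun i hi => hx₀.1 i hi) fun i hi => (hKact hi).2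
  obtain ⟨C, hC, hbound⟩ := R.exists_eventually_forall_linearIndepOn_abs_le p₀
  obtain ⟨δ, hδ, hactive⟩ := R.exists_eventually_active_subset p₀ x₀
  obtain ⟨m, hm, hmlam⟩ : ∃ m > 0, ∀ i ∈ K, m ≤ lam i := by
    rcases K.eq_empty_or_nonempty with rfl | hne
    · exact ⟨1, one_pos, by simp⟩
    · obtain ⟨k, hk, hmin⟩ := K.exists_min_image lam hne
      exact ⟨lam k, hlam k hk, hmin⟩
  -- The last condition keeps the multipliers on `K` within `m` of `lam`; `ε ≤ 1 / 2` serves the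
  -- final bound on `‖v - x‖`.
  obtain ⟨ε, hε, hεδ, hε1, hεm⟩ : ∃ ε > 0, ε ≤ δ ∧ ε ≤ 1 / 2 ∧ C * (2 * ε) ≤ m := by
    refine ⟨min (min δ (1 / 2)) (m / (2 * C)), by positivity,
      (min_le_left _ _).trans (min_le_left _ _), (min_le_left _ _).trans (min_le_right _ _), ?_⟩
    calc C * (2 * min (min δ (1 / 2)) (m / (2 * C))) ≤ C * (2 * (m / (2 * C))) := by
          gcongr; exact min_le_right _ _
      _ = m := by field_simp
  let hh : D → H := fun p => ∑ i ∈ R.eqs ∪ K, lam i • R.g i p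
  have hhcont : Continuous hh := continuous_finsetSum _ fun i _ => (R.continuous_g i).const_smul _
  have hh₀ : hh p₀ = v₀ - x₀ := hlamsum.symm
  have hhev : ∀ᶠ p in 𝓝 p₀, ‖hh p - (v₀ - x₀)‖ < ε / 4 := by
    have := (Metric.tendsto_nhds.1 (hhcont.tendsto p₀)) (ε / 4) (by positivity)
    simpa only [hh₀, dist_eq_norm] using this
  have hv : ∀ᶠ v in 𝓝 v₀, ‖v - v₀‖ < ε / 4 := by
    filter_upwards [Metric.ball_mem_nhds v₀ (show 0 < ε / 4 by positivity)] with v hv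
    rwa [← dist_eq_norm]
  refine ⟨C * (‖v₀ - x₀‖ + 1), by positivity, ?_⟩
  have hp := hhev.and ((eventually_exists_mem_feasible hlim (show 0 < ε / 4 by positivity)).and
    (hbound.and (hactive.and hR.eventually_linearIndepOn)))
  filter_upwards [hp.prod_nhds hv]
  rintro ⟨p, v⟩ ⟨⟨hhp, ⟨z, hz, hzx⟩, hpbound, hpact, hpind⟩, hvv⟩
  simp only at *
  obtain ⟨x, hx⟩ := exists_isMetricProjection ((R.tighten K).convex_feasible p)
    ((R.tighten K).isClosed_feasible p) ⟨z, hz⟩ v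
  have hxN := (isMetricProjection_iff_mem_convexNormalCone
    ((R.tighten K).convex_feasible p) hx.1).1 hx
  -- Both `z` and `x` satisfy the equalities on `eqs ∪ K`, so `hh p` is orthogonal to `z - x`.
  -- Adding it to the projection inequality leaves `z - v + hh p`, which is small because `hh p₀ =
  -- v₀ - x₀`.
  have hzx' : ‖z - x‖ ≤ ‖(z - x₀) - (v - v₀) + (hh p - (v₀ - x₀))‖ := by
    have e0 : inner ℝ (hh p) (z - x) = 0 := by
      simp only [hh, sum_inner, real_inner_smul_left]
      refine Finset.sum_eq_zero fun i hi => ?_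
      have a1 : inner ℝ z (R.g i p) = R.f i p := hz.1 i hi
      have a2 : inner ℝ x (R.g i p) = R.f i p := hx.1.1 i hi
      rw [real_inner_comm, inner_sub_left, a1, a2, sub_self, mul_zero]
    have e1 : (z - x₀) - (v - v₀) + (hh p - (v₀ - x₀)) = (z - x) - (v - x) + hh p := by abel
    have e2 := hxN z hz
    have e3 : ‖z - x‖ * ‖z - x‖ ≤ ‖(z - x) - (v - x) + hh p‖ * ‖z - x‖ := by
      refine le_trans ?_ (real_inner_le_norm _ _)
      rw [inner_add_left, inner_sub_left, e0, real_inner_self_eq_norm_mul_norm]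
      linarith
    rw [e1]
    rcases (norm_nonneg (z - x)).eq_or_lt with h | h
    · rw [← h]; positivity
    · exact le_of_mul_le_mul_right e3 h
  have hxε : ‖x - x₀‖ < ε := by
    have e1 := norm_add_le ((z - x₀) - (v - v₀)) (hh p - (v₀ - x₀))
    have e2 := norm_sub_le (z - x₀) (v - v₀)
    have e3 : ‖x - x₀‖ ≤ ‖z - x₀‖ + ‖z - x‖ := by simpa using norm_sub_le (z - x₀) (z - x)
    linarith
  obtain ⟨L, hL, hind, c, hc, hsum⟩ := exists_representedBy hx.1 hxN
    ((hpind (R.eqs ∪ K) Finset.subset_union_left hEact).2 hKind)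
  change LinearIndepOn ℝ (fun i => R.g i p) (↑(R.eqs ∪ K ∪ L) : Set κ) at hind
  change v - x = ∑ i ∈ R.eqs ∪ K ∪ L, c i • R.g i p at hsum
  have hLact : (L : Set κ) ⊆ R.active p₀ x₀ := fun i hi => hpact x (hxε.trans_le hεδ) (hL hi).2
  have hLnot : ∀ i ∈ L, i ∉ R.eqs ∪ K := fun i hi => (hL hi).1
  have hind₀ := (hpind (R.eqs ∪ K ∪ L)
    (Finset.subset_union_left.trans Finset.subset_union_left) (by
      rw [Finset.coe_union]; exact Set.union_subset hEact hLact)).1 hind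
  have hassoc : R.eqs ∪ (K ∪ L) = R.eqs ∪ K ∪ L := (Finset.union_assoc _ _ _).symm
  -- Expanding `v - x - hh p` over the family `eqs ∪ K ∪ L` gives `|c i - lam i| ≤ C * (2 * ε) ≤ m ≤
  -- lam i` on `K`.
  have hcK : ∀ i ∈ K, 0 ≤ c i := fun i hi => by
    have hdiff : ∑ i ∈ R.eqs ∪ K ∪ L, (c i - if i ∈ R.eqs ∪ K then lam i else 0) • R.g i p =
        (v - v₀) - (x - x₀) - (hh p - (v₀ - x₀)) := by
      have : ∑ i ∈ R.eqs ∪ K ∪ L, (if i ∈ R.eqs ∪ K then lam i else 0) • R.g i p = hh p := by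
        simp only [ite_smul, zero_smul]
        rw [← Finset.sum_filter]
        refine Finset.sum_congr ?_ fun _ _ => rfl
        ext j; simp only [Finset.mem_filter, Finset.mem_union]; tauto
      simp only [sub_smul, Finset.sum_sub_distrib, this, ← hsum]
      abel
    have h1 := hpbound _ hind₀ (fun i => c i - if i ∈ R.eqs ∪ K then lam i else 0) i
      (Finset.mem_union_left _ (Finset.mem_union_right _ hi))
    simp only [hdiff, if_pos (Finset.mem_union_right R.eqs hi)] at h1
    have h2 : ‖(v - v₀) - (x - x₀) - (hh p - (v₀ - x₀))‖ ≤ 2 * ε := by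
      have e1 := norm_sub_le ((v - v₀) - (x - x₀)) (hh p - (v₀ - x₀))
      have e2 := norm_sub_le (v - v₀) (x - x₀)
      linarith
    have h3 : |c i - lam i| ≤ m := h1.trans (le_trans (by gcongr) hεm)
    have := (abs_le.1 h3).1
    linarith [hmlam i hi]
  have hxR : x ∈ R.feasible p := by
    refine ⟨fun i hi => hx.1.1 i (Finset.mem_union_left _ hi), fun i _ => ?_⟩
    exact inner_le_of_mem_feasible hx.1 i
  refine ⟨x, hxR, L, fun i hi => ⟨⟨fun h => hLnot i hi (Finset.mem_union_left _ h), hLact hi⟩,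
    fun h => hLnot i hi (Finset.mem_union_right _ h)⟩, hind₀, ⟨fun i hi => ?_, fun i _ =>
    inner_le_of_mem_feasible hxR i⟩, c, fun i hi => ?_, fun i hi => ?_, ?_⟩
  · have hi' : i ∈ R.eqs ∪ K ∪ L := hassoc ▸ hi
    rcases Finset.mem_union.1 hi' with h | h
    · exact hx.1.1 i h
    · exact (hL h).2
  · rcases Finset.mem_union.1 hi with h | h
    · exact hcK i h
    · exact (hc i h).le
  · rw [hassoc] at hi
    refine (hpbound _ hind₀ c i hi).trans ?_
    rw [← hsum]
    gcongr
    have e : v - x = (v - v₀) - (x - x₀) + (v₀ - x₀) := by abel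
    have e1 := norm_add_le ((v - v₀) - (x - x₀)) (v₀ - x₀)
    have e2 := norm_sub_le (v - v₀) (x - x₀)
    rw [e]
    linarith
  · rw [hassoc, hsum]

end AffineSystem

/-! ### The graphical normal cone multifunction is Lipschitz-like. -/

theorem proposition5p2
    {G : Type*} [NormedAddCommGroup G] [NormedSpace ℝ G] {D : Set G}
    {H : Type*} [NormedAddCommGroup H] [InnerProductSpace ℝ H] [CompleteSpace H]
    {ι : Type*} [Finite ι] {κ : Type*} [Finite κ] [DecidableEq κ]
    (S : AffineSystem D H ι) (p₀ : D) (v₀ x₀ : H)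
    (hv : v₀ ∉ S.feasible p₀)
    (hx : IsMetricProjection (S.feasible p₀) v₀ x₀)
    (R : AffineSystem D H κ) (hRS : R.IsEquivalent S)
    (hstable : R.IsStableAt p₀ v₀ x₀)
    (hrcrcq : R.RCRCQ p₀ x₀) :
    IsLipschitzLike S.graphNormalCone p₀ (x₀, v₀ - x₀) := by
  have hgraph : S.graphNormalCone = R.graphNormalCone := by
    funext p
    simp only [AffineSystem.graphNormalCone, hRS p]
  rw [← hRS p₀] at hx
  rw [hgraph]
  refine ⟨⟨hx.1, (isMetricProjection_iff_mem_convexNormalCone (R.convex_feasible p₀) hx.1).1 hx⟩,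
    ?_⟩
  obtain ⟨K, hK, hlim⟩ := hstable
  have := Fintype.ofFinite κ
  have hlimK : MemKuratowskiLiminf (R.tighten K).feasible p₀ x₀ := by
    have := hlim ∅ (by simp) (by simpa using hK.2.1)
    rwa [Finset.union_empty] at this
  obtain ⟨B, hB, hmult⟩ := hrcrcq.eventually_exists_multiplier hx.1 hK hlimK
  obtain ⟨k, hk, U, hU, hlip⟩ := R.exists_lipschitzOn_nhds p₀
  have hex : ∀ L : Finset κ, ∃ ℓ : ℝ, 0 ≤ ℓ ∧ ∀ᶠ z : (D × D) × H in 𝓝 ((p₀, p₀), x₀),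
      (L : Set κ) ⊆ R.activeIneq p₀ x₀ \ (K : Set κ) →
      LinearIndepOn ℝ (fun i => R.g i p₀) (↑(R.eqs ∪ K ∪ L) : Set κ) →
      z.2 ∈ (R.tighten (K ∪ L)).feasible z.1.1 →
      ∃ y ∈ (R.tighten (K ∪ L)).feasible z.1.2, ‖z.2 - y‖ ≤ ℓ * ‖(z.1.1 : G) - z.1.2‖ := by
    intro L
    by_cases hL : (L : Set κ) ⊆ R.activeIneq p₀ x₀ \ (K : Set κ) ∧
      LinearIndepOn ℝ (fun i => R.g i p₀) (↑(R.eqs ∪ K ∪ L) : Set κ)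
    · obtain ⟨ℓ, hℓ, h⟩ := (hrcrcq.tighten (K ∪ L)).exists_eventually_feasible_near
        (by
          change LinearIndepOn ℝ (fun i => R.g i p₀) (↑(R.eqs ∪ (K ∪ L)) : Set κ)
          rw [← Finset.union_assoc]; exact hL.2)
        (by
          intro i hi
          change i ∈ ((R.eqs ∪ (K ∪ L) : Finset κ) : Set κ) at hi
          rw [Finset.mem_coe, Finset.mem_union, Finset.mem_union] at hi
          rcases hi with hi | hi | hi
          · exact hx.1.1 i hi
          · exact (hK.1 hi).2
          · exact (hL.1 hi).1.2)
        (hlim L hL.1 hL.2)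
      exact ⟨ℓ, hℓ, h.mono fun z hz _ _ => hz⟩
    · exact ⟨0, le_rfl, Filter.Eventually.of_forall fun z h1 h2 => absurd ⟨h1, h2⟩ hL⟩
  choose ℓ hℓ hnear using hex
  let N : ℝ := Fintype.card κ
  let ℓ₁ : ℝ := ∑ L, ℓ L
  have hℓ₁ : 0 ≤ ℓ₁ := Finset.sum_nonneg fun L _ => hℓ L
  have hle : ∀ L, ℓ L ≤ ℓ₁ := fun L =>
    Finset.single_le_sum (fun L _ => hℓ L) (Finset.mem_univ L)
  have hev := Filter.eventually_all.2 hnear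
  rw [nhds_prod_eq, Filter.eventually_prod_iff] at hev
  obtain ⟨P, hP, Q, hQ, hPQ⟩ := hev
  rw [nhds_prod_eq, Filter.eventually_prod_self_iff'] at hP
  obtain ⟨W, hW, hWP⟩ := hP
  rw [nhds_prod_eq, Filter.eventually_prod_iff] at hmult
  obtain ⟨P', hP', Q', hQ', hPQ'⟩ := hmult
  -- The pair `(x, x')` is tested through the point `x` and the projected point `x + x'`.
  have hV : ∀ᶠ z : H × H in 𝓝 (x₀, v₀ - x₀), Q z.1 ∧ Q' (z.1 + z.2) := by
    refine (continuous_fst.tendsto (x₀, v₀ - x₀)).eventually hQ |>.and ?_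
    have hcont : Continuous fun z : H × H => z.1 + z.2 := by fun_prop
    have := hcont.tendsto (x₀, v₀ - x₀)
    simp only [add_sub_cancel] at this
    exact this.eventually hQ'
  -- The summand `1` provides the strict inequality that the open ball requires when `p ≠ q`.
  refine ⟨ℓ₁ + N * (B * k) + 1, by positivity, {p | p ∈ U ∧ p ∈ W ∧ P' p},
    Filter.inter_mem hU (Filter.inter_mem hW hP'), _, hV, ?_⟩
  rintro p ⟨hpU, hpW, hpP⟩ q ⟨hqU, hqW, -⟩ ⟨x, x'⟩ ⟨⟨hxp, hxN⟩, hxQ, hvQ⟩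
  simp only at hxp hxN hxQ hvQ
  obtain ⟨x₁, hx₁, L, hL, hind, hx₁L, c, hc, hcB, hsum⟩ := hPQ' hpP hvQ
  simp only at hx₁ hx₁L hsum
  have hx₁N : x + x' - x₁ ∈ convexNormalCone (R.feasible p) x₁ := by
    rw [hsum]
    refine AffineSystem.sum_mem_convexNormalCone hx₁ (fun i hi => ?_) hc
    exact hx₁L.1 i (Finset.mem_union_right _ hi)
  -- Both points are projections of `x + x'` onto the feasible set at `p`.
  obtain rfl : x = x₁ :=
    eq_of_sub_mem_convexNormalCone (v := x + x') hxp hx₁ (by simpa using hxN) hx₁N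
  rw [add_sub_cancel_left] at hsum
  obtain ⟨y, hy, hxy⟩ := hPQ (hWP p hpW q hqW) hxQ L hL hind hx₁L
  simp only at hy hxy
  have hyR : y ∈ R.feasible q :=
    ⟨fun i hi => hy.1 i (Finset.mem_union_left _ hi), fun i _ =>
      AffineSystem.inner_le_of_mem_feasible hy i⟩
  let y' : H := ∑ i ∈ R.eqs ∪ (K ∪ L), c i • R.g i q
  have hy' : y' ∈ convexNormalCone (R.feasible q) y :=
    AffineSystem.sum_mem_convexNormalCone hyR
      (fun i hi => hy.1 i (Finset.mem_union_right _ hi)) hc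
  have hxy' : ‖x' - y'‖ ≤ N * (B * k) * ‖(p : G) - q‖ := by
    have e : x' - y' = ∑ i ∈ R.eqs ∪ (K ∪ L), c i • (R.g i p - R.g i q) := by
      simp only [y', hsum, smul_sub, Finset.sum_sub_distrib]
    rw [e]
    calc _ ≤ ∑ i ∈ R.eqs ∪ (K ∪ L), B * (k * ‖(p : G) - q‖) :=
          norm_sum_le_of_le _ fun i hi => by
            rw [norm_smul]
            exact mul_le_mul (hcB i hi) (hlip p hpU q hqU i).2 (norm_nonneg _) hB
      _ = (R.eqs ∪ (K ∪ L)).card * (B * (k * ‖(p : G) - q‖)) := by simp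
      _ ≤ N * (B * (k * ‖(p : G) - q‖)) := by
          have : ((R.eqs ∪ (K ∪ L)).card : ℝ) ≤ N := Nat.cast_le.2 (Finset.card_le_univ _)
          gcongr
      _ = _ := by ring
  refine ⟨(y, y'), ⟨hyR, hy'⟩, (x - y, x' - y'), ?_, by simp⟩
  have hxy₁ : ‖x - y‖ ≤ ℓ₁ * ‖(p : G) - q‖ := hxy.trans (by gcongr; exact hle L)
  -- For `p = q` the scaled ball is `{0}`, and the estimates give exact equality.
  rcases (norm_nonneg ((p : G) - q)).eq_or_lt with h | h
  · rw [← h, mul_zero] at hxy₁ hxy'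
    rw [norm_le_zero_iff.1 hxy₁, norm_le_zero_iff.1 hxy', ← h, mul_zero]
    exact ⟨0, by simp, zero_smul ℝ _⟩
  · have hr : 0 < (ℓ₁ + N * (B * k) + 1) * ‖(p : G) - q‖ := by positivity
    rw [smul_unitBall_of_pos hr, mem_ball_zero_iff, Prod.norm_mk, max_lt_iff]
    have h0 : 0 ≤ ℓ₁ * ‖(p : G) - q‖ := by positivity
    have h1 : 0 ≤ N * (B * k) * ‖(p : G) - q‖ := by positivity
    constructor <;> linarith
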